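/- Let $p$ be a prime and let $R$ be a Noetherian reduced commutative ring of characteristic $p$. Let $R^\circ$ be the set of elements of $R$ lying in no minimal prime. For an $R$-module $M$ and $q=p^e$ let $\mathbb F^e(M)={}^eR\otimes_R M$, where ${}^eR$ is $R$ viewed as an $R$-algebra via the $e$-th iterate of Frobenius; put $z^q=1\otimes z$ for $z\in M$, and for a submodule $N\subseteq M$ let $N^{[q]}_M$ be the image of $\mathbb F^e(N)\to\mathbb F^e(M)$. For ideals $\mathfrak a,\mathfrak b$ meeting $R^\circ$ and real numbers $t,s>0$, let $N_M^{*\mathfrak a^t}$ (resp. $N_M^{*\mathfrak a^t\mathfrak b^s}$) be the submodule of all $z\in M$ for which there is $c\in R^\circ$ such that $c\,z^q\,\mathfrak a^{\lceil tq\rceil}\subseteq N^{[q]}_M$ (resp. $c\,z^q\,\mathfrak a^{\lceil tq\rceil}\mathfrak b^{\lceil sq\rceil}\subseteq N^{[q]}_M$) for all large $q=p^e$. For an ideal $I$ write $I^{*\mathfrak a^t}=I_R^{*\mathfrak a^t}$. Let $E=\bigoplus_{\mathfrak m}E_R(R/\mathfrak m)$ be the direct sum, over all maximal ideals, of the injective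 hulls of the residue fields, and put $$\widetilde\tau(\mathfrak a^t)=\operatorname{Ann}_R\bigl(0_E^{*\mathfrak a^t}\bigr),\qquad \tau(\mathfrak a^t)=\bigcap_{M}\operatorname{Ann}_R\bigl(0_M^{*\mathfrak a^t}\bigr),$$ where $M$ runs through all finitely generated submodules of $E$; define $\widetilde\tau(\mathfrak a^t\mathfrak b^s)$ and $\tau(\mathfrak a^t\mathfrak b^s)$ in the same way. (1) If $R$ is F-finite (that is, ${}^1R$ is a finitely generated $R$-module), then for all ideals $\mathfrak a,\mathfrak b$ of $R$ meeting $R^\circ$ and all real numbers $t,s>0$, $$\widetilde\tau(\mathfrak a^t)^{*\mathfrak a^t}\,\widetilde\tau(\mathfrak a^t\mathfrak b^s)\subseteq\widetilde\tau(\mathfrak a^t)\,\widetilde\tau(\mathfrak b^s).$$ (2) If $R$ is a complete local ring, then for all ideals $\mathfrak a,\mathfrak b$ of $R$ of positive height and all real numbers $t,s>0$, $$\tau(\mathfrak a^t)^{*\mathfrak a^t}\,\tau(\mathfrak a^t\mathfrak b^s)\subseteq\tau(\mathfrak a^t)\,\tau(\mathfrak b^s).$$ -/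

import Mathlib

open scoped TensorProduct DirectSum

universe u

namespace TestIdeal

section InjectiveHull

/-- `f : M → E` exhibits `E` as an injective hull of `M`: the module `E` is injective, and `f`
is an injective map whose image is essential, that is, meets every nonzero submodule of `E`
nontrivially. -/
structure IsInjectiveHull {R : Type u} [CommRing R] {M E : Type u} [AddCommGroup M] [Module R M]
    [AddCommGroup E] [Module R E] (f : M →ₗ[R] E) : Prop where
  injective_module : Module.Injective R E
  injective_map : Function.Injective f
  essential : ∀ N : Submodule R E, N ⊓ LinearMap.range f = ⊥ → N = ⊥

/-- Every module has an injective hull. -/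
theorem exists_isInjectiveHull (R : Type u) [CommRing R] (M : Type u) [AddCommGroup M]
    [Module R M] : ∃ (E : ModuleCat.{u} R) (f : M →ₗ[R] E), IsInjectiveHull f := by
  -- embed `M` into an injective module `I`
  let I : ModuleCat.{u} R := CategoryTheory.Injective.under (ModuleCat.of R M)
  let j : M →ₗ[R] I := (CategoryTheory.Injective.ι (ModuleCat.of R M)).hom
  have hj : Function.Injective j :=
    (ModuleCat.mono_iff_injective (CategoryTheory.Injective.ι (ModuleCat.of R M))).1 inferInstance
  have hI : Module.Injective R I := by
    have : CategoryTheory.Injective (ModuleCat.of R I) :=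
      inferInstanceAs (CategoryTheory.Injective
        (CategoryTheory.Injective.under (ModuleCat.of R M)))
    exact Module.injective_module_of_injective_object R I
  -- a maximal essential extension `N` of `M` inside `I`
  let S : Set (Submodule R I) := {N | LinearMap.range j ≤ N ∧
    ∀ K : Submodule R I, K ≤ N → K ⊓ LinearMap.range j = ⊥ → K = ⊥}
  have hS0 : LinearMap.range j ∈ S := by
    refine ⟨le_rfl, fun K hK h => ?_⟩
    rwa [inf_eq_left.2 hK] at h
  obtain ⟨N, -, hN⟩ := zorn_le_nonempty₀ S (by
    intro c hc hchain y hy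
    refine ⟨sSup c, ⟨(hc hy).1.trans (le_sSup hy), fun K hK h => ?_⟩, fun z hz => le_sSup hz⟩
    rw [eq_bot_iff]
    intro x hx
    obtain ⟨z, hz, hxz⟩ :=
      (Submodule.mem_sSup_of_directed ⟨y, hy⟩ hchain.directedOn).1 (hK hx)
    have h1 := (hc hz).2 (K ⊓ z) inf_le_right (by
      rw [eq_bot_iff, ← h]
      exact inf_le_inf_right _ inf_le_left)
    rw [← h1]
    exact ⟨hx, hxz⟩) _ hS0
  -- a maximal submodule `K` of `I` meeting `N` trivially
  obtain ⟨K, -, hK⟩ := zorn_le_nonempty₀ {K : Submodule R I | K ⊓ N = ⊥} (by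
    intro c hc hchain y hy
    refine ⟨sSup c, ?_, fun z hz => le_sSup hz⟩
    change _ = _
    rw [eq_bot_iff]
    rintro x ⟨hx, hxN⟩
    obtain ⟨z, hz, hxz⟩ := (Submodule.mem_sSup_of_directed ⟨y, hy⟩ hchain.directedOn).1 hx
    have h1 : z ⊓ N = ⊥ := hc hz
    rw [← h1]
    exact ⟨hxz, hxN⟩) ⊥ (by simp)
  have hKN : K ⊓ N = ⊥ := hK.prop
  have hmax : ∀ L : Submodule R I, K ≤ L → L ⊓ N = ⊥ → L ≤ K := fun L h1 h2 => hK.2 h2 h1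
  -- extend the inclusion of `N` to `I ⧸ K`
  have hqinj : Function.Injective (K.mkQ ∘ₗ N.subtype) := by
    rw [← LinearMap.ker_eq_bot, eq_bot_iff]
    intro n hn
    have h1 : (n : I) ∈ K := by simpa using hn
    have h2 : (n : I) ∈ K ⊓ N := ⟨h1, n.2⟩
    rw [hKN] at h2
    simpa using h2
  obtain ⟨h, hh⟩ := hI.out (K.mkQ ∘ₗ N.subtype) hqinj N.subtype
  let g : I →ₗ[R] I := h ∘ₗ K.mkQ
  have hg : ∀ n ∈ N, g n = n := fun n hn => hh ⟨n, hn⟩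
  have hgK : ∀ k ∈ K, g k = 0 := by
    intro k hk
    have : K.mkQ k = 0 := by simpa using hk
    simp [g, this]
  -- the image of this extension is again essential over `M`, hence equal to `N`
  have hrS : LinearMap.range g ∈ S := by
    refine ⟨fun x hx => ⟨x, hg x (hN.prop.1 hx)⟩, fun P hP hPj => ?_⟩
    have hPN : P ⊓ N = ⊥ := hN.prop.2 _ inf_le_right (by
      rw [eq_bot_iff, ← hPj]
      exact inf_le_inf_right _ inf_le_left)
    have h1 : P.comap g ≤ K := hmax _ (fun k hk => by simp [hgK k hk]) (by
      rw [eq_bot_iff, ← hPN]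
      rintro x ⟨hx, hxN⟩
      have : g x ∈ P := hx
      rw [hg x hxN] at this
      exact ⟨this, hxN⟩)
    rw [eq_bot_iff]
    intro x hx
    obtain ⟨y, rfl⟩ := hP hx
    simpa using hgK y (h1 hx)
  have hNr : LinearMap.range g ≤ N := hN.2 hrS (fun x hx => ⟨x, hg x hx⟩)
  have hr : ∀ x, g x ∈ N := fun x => hNr ⟨x, rfl⟩
  refine ⟨ModuleCat.of R N, j.codRestrict N (fun x => hN.prop.1 ⟨x, rfl⟩), ⟨⟨?_⟩, ?_, ?_⟩⟩
  · intro X Y _ _ _ _ f hf φ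
    obtain ⟨ψ, hψ⟩ := hI.out f hf (N.subtype ∘ₗ φ)
    refine ⟨(g.codRestrict N hr) ∘ₗ ψ, fun x => Subtype.ext ?_⟩
    have h1 : ψ (f x) = (φ x : I) := hψ x
    change g (ψ (f x)) = _
    rw [h1]
    exact hg _ (φ x).2
  · intro x y hxy
    exact hj (congrArg Subtype.val hxy)
  · intro P hP
    have h1 := hN.prop.2 (P.map N.subtype) (Submodule.map_subtype_le _ _) (by
      rw [eq_bot_iff]
      rintro _ ⟨⟨x, hx, rfl⟩, m, hm⟩
      have h2 : x ∈ P ⊓ LinearMap.range (j.codRestrict N (fun x => hN.prop.1 ⟨x, rfl⟩)) :=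
        ⟨hx, m, Subtype.ext hm⟩
      have h3 : x = 0 := by
        rw [hP] at h2
        exact (Submodule.mem_bot R).1 h2
      simp [h3])
    rw [eq_bot_iff]
    intro x hx
    have h2 : (x : I) ∈ P.map N.subtype := ⟨x, hx, rfl⟩
    rw [h1] at h2
    exact (Submodule.mem_bot R).2 (Subtype.ext ((Submodule.mem_bot R).1 h2))

/-- The injective hull `E_R(M)` of an `R`-module `M`. -/
noncomputable def InjectiveHull (R : Type u) [CommRing R] (M : Type u) [AddCommGroup M]
    [Module R M] : ModuleCat.{u} R :=
  (exists_isInjectiveHull R M).choose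

/-- The embedding `M → E_R(M)`. -/
noncomputable def InjectiveHull.ι (R : Type u) [CommRing R] (M : Type u) [AddCommGroup M]
    [Module R M] : M →ₗ[R] InjectiveHull R M :=
  (exists_isInjectiveHull R M).choose_spec.choose

theorem InjectiveHull.isInjectiveHull (R : Type u) [CommRing R] (M : Type u) [AddCommGroup M]
    [Module R M] : IsInjectiveHull (InjectiveHull.ι R M) :=
  (exists_isInjectiveHull R M).choose_spec.choose_spec

/-- `E = ⨁_𝔪 E_R(R/𝔪)`, the direct sum over all maximal ideals `𝔪` of `R` of the injective hulls
of the residue fields `R/𝔪`. -/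
abbrev ResidueHull (R : Type u) [CommRing R] : Type u :=
  ⨁ m : MaximalSpectrum R, InjectiveHull R (R ⧸ m.asIdeal)

end InjectiveHull

section TightClosure

/-- `R°`: the elements of `R` that lie in no minimal prime ideal. -/
def circ (R : Type u) [CommRing R] : Submonoid R where
  carrier := {x | ∀ P ∈ minimalPrimes R, x ∉ P}
  one_mem' := fun P hP h => hP.1.1.ne_top ((Ideal.eq_top_iff_one P).2 h)
  mul_mem' := fun hx hy P hP h => (hP.1.1.mem_or_mem h).elim (hx P hP) (hy P hP)

/-- The condition `𝔞 ∩ R° ≠ ∅`. -/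
def MeetsCirc {R : Type u} [CommRing R] (𝔞 : Ideal R) : Prop :=
  ((𝔞 : Set R) ∩ (circ R : Set R)).Nonempty

/-- `R` is F-finite: `R` is finitely generated as a module over itself via Frobenius. -/
def IsFFinite (p : ℕ) [Fact p.Prime] (R : Type u) [CommRing R] [CharP R p] : Prop :=
  (frobenius R p).Finite

/-- `ᵉR`: the ring `R`, viewed as an `R`-algebra via the iterated Frobenius `x ↦ x ^ (p ^ e)`. -/
@[nolint unusedArguments]
def FrobeniusTwist (_p _e : ℕ) (R : Type u) : Type u := R

instance (p e : ℕ) (R : Type u) [CommRing R] : CommRing (FrobeniusTwist p e R) :=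
  inferInstanceAs (CommRing R)

/-- The identity map `R → ᵉR` (an isomorphism of rings, not an `R`-linear map). -/
def FrobeniusTwist.of (p e : ℕ) (R : Type u) [CommRing R] : R ≃+* FrobeniusTwist p e R :=
  RingEquiv.refl R

noncomputable instance (p e : ℕ) [Fact p.Prime] (R : Type u) [CommRing R] [CharP R p] :
    Algebra R (FrobeniusTwist p e R) :=
  ((FrobeniusTwist.of p e R).toRingHom.comp (iterateFrobenius R p e)).toAlgebra

theorem FrobeniusTwist.algebraMap_apply (p e : ℕ) [Fact p.Prime] (R : Type u) [CommRing R]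
    [CharP R p] (r : R) :
    algebraMap R (FrobeniusTwist p e R) r = FrobeniusTwist.of p e R (r ^ p ^ e) :=
  rfl

variable (p : ℕ) [Fact p.Prime] {R : Type u} [CommRing R] [CharP R p]

/-- For `N ⊆ M` and `q = p ^ e`, this is `N^{[q]}_M`, the image of the map `𝔽ᵉ(N) → 𝔽ᵉ(M)` induced
by the inclusion, where `𝔽ᵉ(M) = ᵉR ⊗_R M`. It is a submodule for the action of `R` on the
factor `ᵉR`. -/
noncomputable def frobeniusPower {M : Type u} [AddCommGroup M] [Module R M] (N : Submodule R M)
    (e : ℕ) : Submodule (FrobeniusTwist p e R) (FrobeniusTwist p e R ⊗[R] M) :=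
  LinearMap.range (N.subtype.baseChange (FrobeniusTwist p e R))

/-- Given ideals `𝔠 e`, one for each `q = p ^ e`, the submodule of all `z ∈ M` for which there is
`c ∈ R°` with `c z^q 𝔠(e) ⊆ N^{[q]}_M` for all large `q = p ^ e`. Here `z^q = 1 ⊗ z` in
`𝔽ᵉ(M) = ᵉR ⊗_R M`, so that `c x z^q = (c x) ⊗ z`. -/
noncomputable def tightClosureAlong {M : Type u} [AddCommGroup M] [Module R M]
    (𝔠 : ℕ → Ideal R) (N : Submodule R M) : Submodule R M where
  carrier := {z | ∃ c ∈ circ R, ∀ᶠ e in Filter.atTop, ∀ x ∈ 𝔠 e,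
    FrobeniusTwist.of p e R (c * x) ⊗ₜ[R] z ∈ frobeniusPower p N e}
  zero_mem' := ⟨1, one_mem _, Filter.Eventually.of_forall fun e x _ => by
    rw [TensorProduct.tmul_zero]; exact zero_mem _⟩
  add_mem' := by
    rintro y z ⟨c, hc, hy⟩ ⟨d, hd, hz⟩
    refine ⟨c * d, mul_mem hc hd, ?_⟩
    filter_upwards [hy, hz] with e hy hz x hx
    rw [TensorProduct.tmul_add]
    refine add_mem ?_ ?_
    · have h := (frobeniusPower p N e).smul_mem (FrobeniusTwist.of p e R d) (hy x hx)
      rw [TensorProduct.smul_tmul', smul_eq_mul, ← map_mul] at h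
      rwa [show c * d * x = d * (c * x) by ring]
    · have h := (frobeniusPower p N e).smul_mem (FrobeniusTwist.of p e R c) (hz x hx)
      rw [TensorProduct.smul_tmul', smul_eq_mul, ← map_mul] at h
      rwa [show c * d * x = c * (d * x) by ring]
  smul_mem' := by
    rintro r z ⟨c, hc, hz⟩
    refine ⟨c, hc, ?_⟩
    filter_upwards [hz] with e hz x hx
    have h := (frobeniusPower p N e).smul_mem (algebraMap R (FrobeniusTwist p e R) r) (hz x hx)
    rwa [algebraMap_smul, ← TensorProduct.tmul_smul] at h

/-- The ideals `𝔞^⌈t q⌉`, `q = p ^ e`, attached to the formal power `𝔞^t`. -/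
noncomputable def realPower (𝔞 : Ideal R) (t : ℝ) (e : ℕ) : Ideal R :=
  𝔞 ^ ⌈t * (p : ℝ) ^ e⌉₊

/-- The ideals `𝔞^⌈t q⌉ 𝔟^⌈s q⌉`, `q = p ^ e`, attached to the formal product `𝔞^t 𝔟^s`. -/
noncomputable def realPowerMul (𝔞 : Ideal R) (t : ℝ) (𝔟 : Ideal R) (s : ℝ) (e : ℕ) : Ideal R :=
  realPower p 𝔞 t e * realPower p 𝔟 s e

/-- The `𝔞^t`-tight closure `I^{*𝔞^t}` of an ideal `I`, taken in `R`. -/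
noncomputable def idealTightClosure (I 𝔞 : Ideal R) (t : ℝ) : Ideal R :=
  tightClosureAlong p (M := R) (realPower p 𝔞 t) I

/-- `Ann_R(0_E^*)`, for the tight closure along the ideals `𝔠 e` and `E = ⨁_𝔪 E_R(R/𝔪)`. -/
noncomputable def tauTildeAlong (𝔠 : ℕ → Ideal R) : Ideal R :=
  (tightClosureAlong p 𝔠 (⊥ : Submodule R (ResidueHull R))).annihilator

/-- `⋂_M Ann_R(0_M^*)`, for the tight closure along the ideals `𝔠 e`, where `M` runs through the
finitely generated submodules of `E = ⨁_𝔪 E_R(R/𝔪)`. -/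
noncomputable def tauAlong (𝔠 : ℕ → Ideal R) : Ideal R :=
  ⨅ (M : Submodule R (ResidueHull R)) (_ : M.FG),
    (tightClosureAlong p 𝔠 (⊥ : Submodule R M)).annihilator

/-- The ideal `τ̃(𝔞^t)`. -/
noncomputable def tauTilde (𝔞 : Ideal R) (t : ℝ) : Ideal R :=
  tauTildeAlong p (realPower p 𝔞 t)

/-- The ideal `τ̃(𝔞^t 𝔟^s)`. -/
noncomputable def tauTildeMul (𝔞 : Ideal R) (t : ℝ) (𝔟 : Ideal R) (s : ℝ) : Ideal R :=
  tauTildeAlong p (realPowerMul p 𝔞 t 𝔟 s)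

/-- The ideal `τ(𝔞^t)`. -/
noncomputable def tau (𝔞 : Ideal R) (t : ℝ) : Ideal R :=
  tauAlong p (realPower p 𝔞 t)

/-- The ideal `τ(𝔞^t 𝔟^s)`. -/
noncomputable def tauMul (𝔞 : Ideal R) (t : ℝ) (𝔟 : Ideal R) (s : ℝ) : Ideal R :=
  tauAlong p (realPowerMul p 𝔞 t 𝔟 s)

end TightClosure

end TestIdeal

/-!
Let `E = ⨁ E_R(R/𝔪)`, and let `K ⊆ K' ⊆ E` be the tight closures of zero along `𝔟^s` and along
`𝔞^t 𝔟^s` (in part (2), the unions of those taken in finitely generated submodules of `E`). If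
`I z ⊆ K`, then `I^{*𝔞^t} z ⊆ K'`: multiply the two membership relations and combine their
multipliers. Since `E` is a cogenerator, the ideal `I Ann(K)` is the annihilator of
`N = Ann_E(I Ann(K))`, and `I N` is killed by `Ann(K)`. So as soon as `Ann_E(Ann_R(K)) = K` we get
`I^{*𝔞^t} N ⊆ K'`, whence `I^{*𝔞^t} Ann(K')` kills `N`.

The double annihilator property of `K` is Matlis duality when `R` is complete local. When `R` is
F-finite it comes from a test element: some `c ∈ R°` is, for every `d ∈ R°`, the value at `d` of
`R`-linear maps `ᵉR → R` with `e` arbitrarily large. Because `E` is a sum of injective modules,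
`a ⊗ z = 0` in `ᵉR ⊗ E` means that `z` is killed by the values at `a` of all such maps, and
composing these maps with those producing `c` shows that every `z` killed by `τ̃` satisfies
`c z^q 𝔟^⌈s q⌉ = 0` for all `q`. To find `c`, split a surjection `Rⁿ → ¹R` generically: the ideals
`J_e(d)` of values at `d` satisfy `b J_e(d) ⊆ J_{e+1}(d)^p` for one `b ∈ R°`, so that after
inverting `b` they stabilize at an idempotent ideal, which is the unit ideal because it contains
the nonzerodivisor `d`; a power of `b` then lies in some `J_e(d)`, and a further trace bounds the
exponent.
-/

namespace TestIdeal

section Injective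

variable {R : Type u} [CommRing R]

theorem exists_comp_eq_of_ker_le {X Y E : Type u} [AddCommGroup X] [Module R X] [AddCommGroup Y]
    [Module R Y] [AddCommGroup E] [Module R E] (hE : Module.Injective R E) {α : X →ₗ[R] Y}
    {β : X →ₗ[R] E} (h : LinearMap.ker α ≤ LinearMap.ker β) : ∃ g : Y →ₗ[R] E, g ∘ₗ α = β := by
  obtain ⟨g, hg⟩ := hE.out ((LinearMap.ker α).liftQ α le_rfl)
    (LinearMap.ker_eq_bot.1 (Submodule.ker_liftQ_eq_bot' _ α rfl)) ((LinearMap.ker α).liftQ β h)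
  exact ⟨g, LinearMap.ext fun x => hg (Submodule.Quotient.mk x)⟩

theorem IsInjectiveHull.exists_map_ne_zero {𝔪 : Ideal R} (h𝔪 : 𝔪 ≠ ⊤) {E : Type u}
    [AddCommGroup E] [Module R E] {f : (R ⧸ 𝔪) →ₗ[R] E} (hf : IsInjectiveHull f) {M : Type u}
    [AddCommGroup M] [Module R M] {x : M} (hx : Ideal.torsionOf R M x ≤ 𝔪) :
    ∃ g : M →ₗ[R] E, g x ≠ 0 := by
  have hker : LinearMap.ker (LinearMap.toSpanSingleton R M x) ≤ LinearMap.ker (f ∘ₗ 𝔪.mkQ) :=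
    fun r hr => by
      rw [LinearMap.mem_ker, LinearMap.comp_apply, Submodule.mkQ_apply,
        (Submodule.Quotient.mk_eq_zero 𝔪).2 (hx hr), map_zero]
  obtain ⟨g, hg⟩ := exists_comp_eq_of_ker_le hf.injective_module hker
  have : Nontrivial (R ⧸ 𝔪) := Ideal.Quotient.nontrivial_iff.2 h𝔪
  have hgx : g x = f 1 := by simpa using LinearMap.congr_fun hg 1
  exact ⟨g, hgx ▸ (map_ne_zero_iff f hf.injective_map).2 one_ne_zero⟩

/-- `E` is a cogenerator of the category of `R`-modules: the linear maps into `E` separate the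
points of every module. -/
def IsCogenerator (R : Type u) [CommRing R] (E : Type u) [AddCommGroup E] [Module R E] : Prop :=
  ∀ ⦃M : Type u⦄ [AddCommGroup M] [Module R M] (x : M), x ≠ 0 → ∃ g : M →ₗ[R] E, g x ≠ 0

theorem isCogenerator_residueHull (R : Type u) [CommRing R] : IsCogenerator R (ResidueHull R) := by
  classical
  intro M _ _ x hx
  obtain ⟨𝔪, h𝔪, hle⟩ := Ideal.exists_le_maximal (Ideal.torsionOf R M x)
    (mt (Ideal.torsionOf_eq_top_iff R x).1 hx)
  obtain ⟨g, hg⟩ := (InjectiveHull.isInjectiveHull R (R ⧸ 𝔪)).exists_map_ne_zero h𝔪.ne_top hle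
  let incl := DirectSum.lof R (MaximalSpectrum R) (fun m => InjectiveHull R (R ⧸ m.asIdeal)) ⟨𝔪, h𝔪⟩
  exact ⟨incl ∘ₗ g, (map_ne_zero_iff incl (DirectSum.of_injective _)).2 hg⟩

theorem IsInjectiveHull.isCogenerator [IsLocalRing R] {E : Type u} [AddCommGroup E] [Module R E]
    {f : (R ⧸ IsLocalRing.maximalIdeal R) →ₗ[R] E} (hf : IsInjectiveHull f) :
    IsCogenerator R E := fun _ _ _ x hx =>
  hf.exists_map_ne_zero (IsLocalRing.maximalIdeal.isMaximal R).ne_top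
    (IsLocalRing.le_maximalIdeal (mt (Ideal.torsionOf_eq_top_iff R x).1 hx))

namespace IsCogenerator

variable {E : Type u} [AddCommGroup E] [Module R E]

theorem annihilator_torsionBySet (hE : IsCogenerator R E) (I : Ideal R) :
    (Submodule.torsionBySet R E I).annihilator = I := by
  refine le_antisymm (fun r hr => ?_) fun r hr => Submodule.mem_annihilator.2 fun x hx =>
    (Submodule.mem_torsionBySet_iff _ _).1 hx ⟨r, hr⟩
  by_contra hrI
  obtain ⟨g, hg⟩ := hE (Ideal.Quotient.mk I r) (mt Ideal.Quotient.eq_zero_iff_mem.1 hrI)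
  have hg1 : g 1 ∈ Submodule.torsionBySet R E I :=
    (Submodule.mem_torsionBySet_iff _ _).2 fun a => by
      rw [← map_smul, Algebra.smul_def, mul_one, Ideal.Quotient.algebraMap_eq,
        Ideal.Quotient.eq_zero_iff_mem.2 a.2, map_zero]
  apply hg
  rw [← Submodule.mem_annihilator.1 hr _ hg1, ← map_smul, Algebra.smul_def, mul_one,
    Ideal.Quotient.algebraMap_eq]

theorem mul_annihilator_le (hE : IsCogenerator R E) {I J : Ideal R} {K K' : Submodule R E}
    (hK : Submodule.torsionBySet R E K.annihilator ≤ K)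
    (h : ∀ N : Submodule R E, I • N ≤ K → J • N ≤ K') :
    J * K'.annihilator ≤ I * K.annihilator := by
  set N := Submodule.torsionBySet R E (I * K.annihilator : Ideal R) with hN
  have hIN : I • N ≤ K := Submodule.smul_le.2 fun i hi x hx => hK <|
    (Submodule.mem_torsionBySet_iff _ _).2 fun a => by
      rw [smul_smul, mul_comm]
      exact (Submodule.mem_torsionBySet_iff _ _).1 hx ⟨i * a, Ideal.mul_mem_mul hi a.2⟩
  rw [← hE.annihilator_torsionBySet (I * K.annihilator), ← hN, Submodule.le_annihilator_iff,
    mul_comm, mul_smul, ← Submodule.le_annihilator_iff]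
  exact Submodule.annihilator_mono (h N hIN)

end IsCogenerator

end Injective

section TensorDuality

variable {R : Type u} [CommRing R] {M : Type u} [AddCommGroup M] [Module R M]

theorem smul_eq_zero_of_tmul_eq_zero {E : Type*} [AddCommGroup E] [Module R E] {w : M} {z : E}
    (h : w ⊗ₜ[R] z = 0) (φ : M →ₗ[R] R) : φ w • z = 0 := by
  simpa using congrArg (fun t => TensorProduct.lid R E (LinearMap.rTensor E φ t)) h

theorem tmul_eq_sum_single_tmul {n : ℕ} {E : Type*} [AddCommGroup E] [Module R E] (v : Fin n → R)
    (z : E) : v ⊗ₜ[R] z = ∑ i, (Pi.single i 1 : Fin n → R) ⊗ₜ[R] (v i • z) := by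
  conv_lhs => rw [pi_eq_sum_univ' v, TensorProduct.sum_tmul]
  simp only [TensorProduct.smul_tmul]

theorem tmul_eq_zero_of_forall_dual_smul_eq_zero [Module.FinitePresentation R M] {E : Type u}
    [AddCommGroup E] [Module R E] (hE : Module.Injective R E) {w : M} {z : E}
    (h : ∀ φ : M →ₗ[R] R, φ w • z = 0) : w ⊗ₜ[R] z = 0 := by
  obtain ⟨n, m, π, γ, hπ, hexact⟩ := Module.FinitePresentation.exists_fin' R M
  obtain ⟨v, rfl⟩ := hπ w
  -- Functionals on `Rⁿ` killed by `γ` descend to `M`, so `φ ↦ φ v • z` extends along `γ*`.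
  have hker : LinearMap.ker (γ.lcomp R R) ≤
      LinearMap.ker (LinearMap.toSpanSingleton R E z ∘ₗ LinearMap.applyₗ v) := by
    intro φ hφ
    have hφγ : LinearMap.ker π ≤ LinearMap.ker φ := by
      rw [hexact.linearMap_ker_eq, LinearMap.range_le_ker_iff]
      exact hφ
    simpa using h ((LinearMap.ker π).liftQ φ hφγ ∘ₗ (π.quotKerEquivOfSurjective hπ).symm)
  obtain ⟨g, hg⟩ := exists_comp_eq_of_ker_le hE hker
  have hcoord (i : Fin n) :
      v i • z = ∑ j, γ (Pi.single j 1) i • g (LinearMap.proj j) := by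
    have hproj : γ.lcomp R R (LinearMap.proj i) =
        ∑ j, γ (Pi.single j 1) i • LinearMap.proj j := by
      ext j
      simp [Pi.single_apply]
    simpa [hproj] using (LinearMap.congr_fun hg (LinearMap.proj i)).symm
  have hv : v ⊗ₜ[R] z = ∑ j, γ (Pi.single j 1) ⊗ₜ[R] g (LinearMap.proj j) := by
    simp only [tmul_eq_sum_single_tmul v, tmul_eq_sum_single_tmul (γ _), hcoord,
      TensorProduct.tmul_sum]
    exact Finset.sum_comm
  simpa [hexact.apply_apply_eq_zero] using congrArg (π.rTensor E) hv

theorem tmul_residueHull_eq_zero [Module.FinitePresentation R M] {w : M} {z : ResidueHull R}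
    (h : ∀ φ : M →ₗ[R] R, φ w • z = 0) : w ⊗ₜ[R] z = 0 := by
  classical
  refine (TensorProduct.directSumRight R R M _).injective (DFinsupp.ext fun m => ?_)
  rw [TensorProduct.directSumRight_tmul, map_zero]
  exact tmul_eq_zero_of_forall_dual_smul_eq_zero
    (InjectiveHull.isInjectiveHull R (R ⧸ m.asIdeal)).injective_module
    fun φ => by rw [← DirectSum.smul_apply, h φ]; rfl

end TensorDuality

section TightClosure

variable (p : ℕ) [Fact p.Prime] {R : Type u} [CommRing R] [CharP R p]
variable {M : Type u} [AddCommGroup M] [Module R M]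

theorem mem_tightClosureAlong {𝔠 : ℕ → Ideal R} {N : Submodule R M} {z : M} :
    z ∈ tightClosureAlong p 𝔠 N ↔ ∃ c ∈ circ R, ∀ᶠ e in Filter.atTop, ∀ x ∈ 𝔠 e,
      FrobeniusTwist.of p e R (c * x) ⊗ₜ[R] z ∈ N.baseChange (FrobeniusTwist p e R) :=
  Iff.rfl

theorem mem_tightClosureAlong_bot {𝔠 : ℕ → Ideal R} {z : M} :
    z ∈ tightClosureAlong p 𝔠 (⊥ : Submodule R M) ↔ ∃ c ∈ circ R, ∀ᶠ e in Filter.atTop,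
      ∀ x ∈ 𝔠 e, FrobeniusTwist.of p e R (c * x) ⊗ₜ[R] z = 0 := by
  simp only [mem_tightClosureAlong, Submodule.baseChange_bot, Submodule.mem_bot]

variable {p} in
theorem tmul_mem_of_dvd {e : ℕ} {P : Submodule (FrobeniusTwist p e R) (FrobeniusTwist p e R ⊗[R] M)}
    {a b : R} (hab : a ∣ b) {z : M} (h : FrobeniusTwist.of p e R a ⊗ₜ[R] z ∈ P) :
    FrobeniusTwist.of p e R b ⊗ₜ[R] z ∈ P := by
  obtain ⟨c, rfl⟩ := hab
  rw [mul_comm, map_mul, ← smul_eq_mul, ← TensorProduct.smul_tmul']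
  exact P.smul_mem _ h

theorem baseChange_mem_baseChange_map {A : Type*} [CommRing A] [Algebra R A] {M' : Type*}
    [AddCommGroup M'] [Module R M'] (f : M →ₗ[R] M') (N : Submodule R M) {t : A ⊗[R] M}
    (ht : t ∈ N.baseChange A) : f.baseChange A t ∈ (N.map f).baseChange A := by
  suffices N.baseChange A ≤ ((N.map f).baseChange A).comap (f.baseChange A) from this ht
  rw [Submodule.baseChange_eq_span, Submodule.span_le]
  rintro _ ⟨n, hn, rfl⟩
  exact Submodule.tmul_mem_baseChange_of_mem _ (Submodule.mem_map_of_mem hn)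

theorem smul_mem_of_mem_baseChange {A : Type*} [CommRing A] [Algebra R A] {N : Submodule R M}
    {P : Submodule A (A ⊗[R] M)} {a : A} (h : ∀ n ∈ N, a ⊗ₜ[R] n ∈ P) {t : A ⊗[R] M}
    (ht : t ∈ N.baseChange A) : a • t ∈ P := by
  suffices N.baseChange A ≤ P.comap (LinearMap.lsmul A _ a) from this ht
  rw [Submodule.baseChange_eq_span, Submodule.span_le]
  rintro _ ⟨n, hn, rfl⟩
  simpa [TensorProduct.smul_tmul'] using h n hn

theorem map_tightClosureAlong_le {M' : Type u} [AddCommGroup M'] [Module R M'] (f : M →ₗ[R] M')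
    (𝔠 : ℕ → Ideal R) (N : Submodule R M) :
    (tightClosureAlong p 𝔠 N).map f ≤ tightClosureAlong p 𝔠 (N.map f) := by
  rintro _ ⟨z, ⟨c, hc, hz⟩, rfl⟩
  exact ⟨c, hc, hz.mono fun e he x hx => baseChange_mem_baseChange_map f N (he x hx)⟩

theorem exists_forall_tmul_mem_baseChange {𝔠 : ℕ → Ideal R} {L N : Submodule R M} (hN : N.FG)
    (h : N ≤ tightClosureAlong p 𝔠 L) :
    ∃ d ∈ circ R, ∀ᶠ e in Filter.atTop, ∀ x ∈ 𝔠 e, ∀ n ∈ N,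
      FrobeniusTwist.of p e R (d * x) ⊗ₜ[R] n ∈ L.baseChange (FrobeniusTwist p e R) := by
  induction N, hN using Submodule.fg_induction with
  | singleton z =>
    obtain ⟨d, hd, hz⟩ := h (Submodule.mem_span_singleton_self z)
    refine ⟨d, hd, hz.mono fun e he x hx n hn => ?_⟩
    obtain ⟨r, rfl⟩ := Submodule.mem_span_singleton.1 hn
    rw [TensorProduct.tmul_smul]
    exact Submodule.smul_of_tower_mem _ r (he x hx)
  | sup N₁ N₂ _ _ h₁ h₂ =>
    obtain ⟨d₁, hd₁, h₁⟩ := h₁ (le_sup_left.trans h)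
    obtain ⟨d₂, hd₂, h₂⟩ := h₂ (le_sup_right.trans h)
    refine ⟨d₁ * d₂, mul_mem hd₁ hd₂, ?_⟩
    filter_upwards [h₁, h₂] with e h₁ h₂ x hx n hn
    obtain ⟨n₁, hn₁, n₂, hn₂, rfl⟩ := Submodule.mem_sup.1 hn
    rw [TensorProduct.tmul_add]
    exact add_mem (tmul_mem_of_dvd ⟨d₂, by ring⟩ (h₁ x hx n₁ hn₁))
      (tmul_mem_of_dvd ⟨d₁, by ring⟩ (h₂ x hx n₂ hn₂))

theorem tightClosureAlong_smul_le {𝔠 𝔡 : ℕ → Ideal R} {I : Ideal R} (hI : I.FG)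
    {L N : Submodule R M} (h : I • N ≤ tightClosureAlong p 𝔡 L) :
    tightClosureAlong p (M := R) 𝔠 I • N ≤ tightClosureAlong p (𝔠 * 𝔡) L := by
  refine Submodule.smul_le.2 fun y ⟨c, hc, hy⟩ z hz => ?_
  set f := LinearMap.toSpanSingleton R M z
  have hIz : Submodule.map f I ≤ tightClosureAlong p 𝔡 L := by
    rintro _ ⟨i, hi, rfl⟩
    exact h (Submodule.smul_mem_smul hi hz)
  obtain ⟨d, hd, hIz⟩ := exists_forall_tmul_mem_baseChange p (Submodule.FG.map f hI) hIz
  refine ⟨c * d, mul_mem hc hd, ?_⟩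
  filter_upwards [hy, hIz] with e hy hIz x hx
  refine Submodule.mul_induction_on hx (fun a ha b hb => ?_) fun a b ha hb => ?_
  · have hfy := baseChange_mem_baseChange_map f I (hy a ha)
    have := smul_mem_of_mem_baseChange (hIz b hb) hfy
    rwa [LinearMap.baseChange_tmul, TensorProduct.smul_tmul', smul_eq_mul, ← map_mul,
      show d * b * (c * a) = c * d * (a * b) by ring] at this
  · rw [mul_add, map_add, TensorProduct.add_tmul]
    exact add_mem ha hb

end TightClosure

section Finitistic

variable (p : ℕ) [Fact p.Prime] {R : Type u} [CommRing R] [CharP R p]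
variable {E : Type u} [AddCommGroup E] [Module R E]

/-- The tight closure of zero computed inside the submodule `M` of `E`, as a submodule of `E`. -/
noncomputable def zeroClosureIn (𝔠 : ℕ → Ideal R) (M : Submodule R E) : Submodule R E :=
  (tightClosureAlong p 𝔠 (⊥ : Submodule R M)).map M.subtype

variable (E) in
/-- The finitistic tight closure of zero in `E` along the ideals `𝔠 e`: the union of the
tight closures of zero in the finitely generated submodules of `E`. -/
noncomputable def finitisticTightClosure (𝔠 : ℕ → Ideal R) : Submodule R E :=
  ⨆ M : {M : Submodule R E // M.FG}, zeroClosureIn p 𝔠 M.1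

theorem zeroClosureIn_mono (𝔠 : ℕ → Ideal R) {M M' : Submodule R E} (h : M ≤ M') :
    zeroClosureIn p 𝔠 M ≤ zeroClosureIn p 𝔠 M' := by
  rw [zeroClosureIn, ← Submodule.subtype_comp_inclusion M M' h, Submodule.map_comp]
  refine Submodule.map_mono ((map_tightClosureAlong_le p _ 𝔠 ⊥).trans_eq ?_)
  rw [Submodule.map_bot]

theorem annihilator_zeroClosureIn (𝔠 : ℕ → Ideal R) (M : Submodule R E) :
    (zeroClosureIn p 𝔠 M).annihilator =
      (tightClosureAlong p 𝔠 (⊥ : Submodule R M)).annihilator :=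
  ((Submodule.equivMapOfInjective _ M.subtype_injective _).annihilator_eq).symm

theorem annihilator_finitisticTightClosure (𝔠 : ℕ → Ideal R) :
    (finitisticTightClosure p (ResidueHull R) 𝔠).annihilator = tauAlong p 𝔠 := by
  simp only [finitisticTightClosure, Submodule.annihilator_iSup, annihilator_zeroClosureIn,
    tauAlong, iInf_subtype]

theorem exists_le_zeroClosureIn {𝔠 : ℕ → Ideal R} {L : Submodule R E} (hL : L.FG)
    (h : L ≤ finitisticTightClosure p E 𝔠) :
    ∃ M : Submodule R E, M.FG ∧ L ≤ zeroClosureIn p 𝔠 M := by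
  have hdir : Directed (· ≤ ·) fun M : {M : Submodule R E // M.FG} => zeroClosureIn p 𝔠 M.1 :=
    fun M M' => ⟨⟨M.1 ⊔ M'.1, M.2.sup M'.2⟩, zeroClosureIn_mono p 𝔠 le_sup_left,
      zeroClosureIn_mono p 𝔠 le_sup_right⟩
  obtain ⟨_, ⟨M, rfl⟩, hM⟩ := (CompleteLattice.isCompactElement_iff_le_of_directed_sSup_le _ _).1
    ((Submodule.fg_iff_compact L).1 hL) _
      (Set.range_nonempty_iff_nonempty.2 ⟨⟨⊥, Submodule.fg_bot⟩⟩) hdir.directedOn_range h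
  exact ⟨M.1, M.2, hM⟩

theorem finitisticTightClosure_smul_le {𝔠 𝔡 : ℕ → Ideal R} {I : Ideal R} (hI : I.FG)
    {N : Submodule R E} (h : I • N ≤ finitisticTightClosure p E 𝔡) :
    tightClosureAlong p (M := R) 𝔠 I • N ≤ finitisticTightClosure p E (𝔠 * 𝔡) := by
  refine Submodule.smul_le.2 fun y hy z hz => ?_
  obtain ⟨M₀, hM₀, hIz⟩ := exists_le_zeroClosureIn p
    (Submodule.FG.smul hI (Submodule.fg_span_singleton z)) ((smul_mono_right I
      ((Submodule.span_singleton_le_iff_mem z N).2 hz)).trans h)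
  set M := M₀ ⊔ Submodule.span R {z}
  let z' : M := ⟨z, Submodule.mem_sup_right (Submodule.mem_span_singleton_self z)⟩
  have hIz' : I • Submodule.span R {z'} ≤ tightClosureAlong p 𝔡 ⊥ := by
    rw [← Submodule.map_le_map_iff_of_injective M.subtype_injective, Submodule.map_smul'',
      Submodule.map_span, Set.image_singleton]
    exact hIz.trans (zeroClosureIn_mono p 𝔡 (le_sup_left : M₀ ≤ M))
  refine Submodule.mem_iSup_of_mem ⟨M, hM₀.sup (Submodule.fg_span_singleton z)⟩ ?_
  exact ⟨y • z', tightClosureAlong_smul_le p hI hIz'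
    (Submodule.smul_mem_smul hy (Submodule.mem_span_singleton_self z')), rfl⟩

end Finitistic

section MatlisDuality

theorem mem_torsionBySet_iff_le_torsionOf {R E : Type*} [CommRing R] [AddCommGroup E] [Module R E]
    {I : Ideal R} {x : E} : x ∈ Submodule.torsionBySet R E I ↔ I ≤ Ideal.torsionOf R E x := by
  simp [Submodule.mem_torsionBySet_iff, SetLike.le_def]

theorem IsInjectiveHull.exists_smul_mem_range {R M E : Type u} [CommRing R] [AddCommGroup M]
    [Module R M] [AddCommGroup E] [Module R E] {f : M →ₗ[R] E} (hf : IsInjectiveHull f) {x : E}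
    (hx : x ≠ 0) : ∃ r : R, r • x ≠ 0 ∧ r • x ∈ LinearMap.range f := by
  have hne : Submodule.span R {x} ⊓ LinearMap.range f ≠ ⊥ := fun h =>
    hx (Submodule.span_singleton_eq_bot.1 (hf.essential _ h))
  obtain ⟨y, ⟨hy, hyf⟩, hy0⟩ := (Submodule.ne_bot_iff _).1 hne
  obtain ⟨r, rfl⟩ := Submodule.mem_span_singleton.1 hy
  exact ⟨r, hy0, hyf⟩

theorem range_eq_span_singleton {R E : Type*} [CommRing R] [AddCommGroup E] [Module R E]
    {I : Ideal R} (f : (R ⧸ I) →ₗ[R] E) : LinearMap.range f = Submodule.span R {f 1} := by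
  have hspan : Submodule.span R {(1 : R ⧸ I)} = ⊤ := by
    rw [← Submodule.range_mkQ I, LinearMap.range_eq_map, ← Ideal.span_singleton_one,
      Ideal.span, Submodule.map_span, Set.image_singleton]
    rfl
  rw [LinearMap.range_eq_map, ← hspan, Submodule.map_span, Set.image_singleton]

open IsLocalRing

variable {R : Type u} [CommRing R] [IsLocalRing R]

theorem exists_notMem_forall_mul_mem {I : Ideal R} (hI : I ≠ ⊤) {n : ℕ}
    (h : maximalIdeal R ^ n ≤ I) : ∃ a ∉ I, ∀ b ∈ maximalIdeal R, b * a ∈ I := by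
  classical
  have hex : ∃ n, maximalIdeal R ^ n ≤ I := ⟨n, h⟩
  obtain ⟨k, hk⟩ := Nat.exists_eq_succ_of_ne_zero (n := Nat.find hex) fun h0 => hI <| by
    simpa [h0] using Nat.find_spec hex
  obtain ⟨a, ha, haI⟩ := SetLike.not_le_iff_exists.1 (Nat.find_min hex (m := k) (by lia))
  refine ⟨a, haI, fun b hb => Nat.find_spec hex ?_⟩
  rw [hk, Nat.succ_eq_add_one, pow_succ']
  exact Ideal.mul_mem_mul hb ha

variable {E : Type u} [AddCommGroup E] [Module R E] {f : (R ⧸ maximalIdeal R) →ₗ[R] E}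

namespace IsInjectiveHull

theorem range_eq_torsionBySet (hf : IsInjectiveHull f) :
    LinearMap.range f = Submodule.torsionBySet R E (maximalIdeal R) := by
  ext x
  rw [Submodule.mem_torsionBySet_iff]
  constructor
  · rintro ⟨y, rfl⟩ b
    rw [← map_smul, Module.mem_annihilator.1 (Ideal.annihilator_quotient.ge b.2) y, map_zero]
  · intro hx
    by_cases hx0 : x = 0
    · exact hx0 ▸ zero_mem _
    obtain ⟨r, hrx, hr⟩ := hf.exists_smul_mem_range hx0
    obtain ⟨u, rfl⟩ : IsUnit r := by
      by_contra h
      exact hrx (hx ⟨r, h⟩)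
    simpa using (LinearMap.range f).smul_mem (↑u⁻¹ : R) hr

theorem exists_smul_of_mem_range (hf : IsInjectiveHull f) (φ : E →ₗ[R] E) :
    ∃ s : R, ∀ x ∈ LinearMap.range f, φ x = s • x := by
  have hφ : φ (f 1) ∈ LinearMap.range f := by
    have h1 : f 1 ∈ LinearMap.range f := ⟨1, rfl⟩
    rw [hf.range_eq_torsionBySet, Submodule.mem_torsionBySet_iff] at h1 ⊢
    exact fun b => by rw [← map_smul, h1 b, map_zero]
  rw [range_eq_span_singleton] at hφ ⊢
  obtain ⟨s, hs⟩ := Submodule.mem_span_singleton.1 hφ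
  refine ⟨s, fun x hx => ?_⟩
  obtain ⟨t, rfl⟩ := Submodule.mem_span_singleton.1 hx
  rw [map_smul, ← hs, smul_comm]

theorem exists_pow_le_torsionOf [IsNoetherianRing R] (hf : IsInjectiveHull f) (x : E) :
    ∃ n : ℕ, maximalIdeal R ^ n ≤ Ideal.torsionOf R E x := by
  refine Ideal.exists_pow_le_of_le_radical_of_fg (fun y hy => ?_)
    (maximalIdeal R).fg_of_isNoetherianRing
  let K : ℕ →o Ideal R := ⟨fun n => Ideal.torsionOf R E (y ^ n • x),
    monotone_nat_of_le_succ fun n r hr => by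
      rw [Ideal.mem_torsionOf_iff] at hr ⊢
      rw [pow_succ', mul_smul, smul_comm, hr, smul_zero]⟩
  obtain ⟨n, hn⟩ := monotone_stabilizes_iff_noetherian.2 ‹IsNoetherianRing R› K
  refine ⟨n, ?_⟩
  by_contra hnx
  obtain ⟨r, hrx, hr⟩ := hf.exists_smul_mem_range hnx
  refine hrx ((hn (n + 1) n.le_succ).ge ?_)
  rw [hf.range_eq_torsionBySet, Submodule.mem_torsionBySet_iff] at hr
  change r • y ^ (n + 1) • x = 0
  rw [pow_succ', mul_smul, smul_comm]
  exact hr ⟨y, hy⟩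

theorem exists_smul_smul_of_forall_eq_zero (hf : IsInjectiveHull f) {I : Ideal R} {a : R}
    (ha : ∀ b ∈ maximalIdeal R, b * a ∈ I) {φ : E →ₗ[R] E}
    (hφ : ∀ x ∈ Submodule.torsionBySet R E (I ⊔ Ideal.span {a} : Ideal R), φ x = 0) :
    ∃ s : R, ∀ x ∈ Submodule.torsionBySet R E I, φ x = s • a • x := by
  set N := Submodule.torsionBySet R E I
  have hker : LinearMap.ker (LinearMap.lsmul R E a ∘ₗ N.subtype) ≤ LinearMap.ker (φ ∘ₗ N.subtype) :=
    fun x hx => hφ x <| mem_torsionBySet_iff_le_torsionOf.2 <| sup_le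
      (mem_torsionBySet_iff_le_torsionOf.1 x.2) ((Ideal.span_singleton_le_iff_mem _).2 hx)
  obtain ⟨g, hg⟩ := exists_comp_eq_of_ker_le hf.injective_module hker
  obtain ⟨s, hs⟩ := hf.exists_smul_of_mem_range g
  refine ⟨s, fun x hx => ?_⟩
  have hax : a • x ∈ LinearMap.range f := by
    rw [hf.range_eq_torsionBySet, Submodule.mem_torsionBySet_iff]
    intro b
    rw [← mul_smul]
    exact mem_torsionBySet_iff_le_torsionOf.1 hx (ha b b.2)
  rw [← hs _ hax]
  exact (LinearMap.congr_fun hg ⟨x, hx⟩).symm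

theorem exists_smul_of_pow_le [IsNoetherianRing R] (hf : IsInjectiveHull f) (φ : E →ₗ[R] E)
    (I : Ideal R) {n : ℕ} (hn : maximalIdeal R ^ n ≤ I) :
    ∃ r : R, ∀ x ∈ Submodule.torsionBySet R E I, φ x = r • x := by
  induction I using WellFoundedGT.induction with | _ I ih
  by_cases hI : I = ⊤
  · subst hI
    refine ⟨0, fun x hx => ?_⟩
    rw [← one_smul R x, (Submodule.mem_torsionBySet_iff _ _).1 hx ⟨1, Submodule.mem_top⟩]
    simp
  obtain ⟨a, haI, ha⟩ := exists_notMem_forall_mul_mem hI hn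
  have hlt : I < I ⊔ Ideal.span {a} :=
    left_lt_sup.2 fun h => haI (h (Ideal.mem_span_singleton_self a))
  obtain ⟨r, hr⟩ := ih _ hlt (hn.trans hlt.le)
  obtain ⟨s, hs⟩ := hf.exists_smul_smul_of_forall_eq_zero ha
    (φ := φ - LinearMap.lsmul R E r) fun x hx => sub_eq_zero.2 (hr x hx)
  refine ⟨r + s * a, fun x hx => ?_⟩
  rw [add_smul, mul_smul, ← hs x hx]
  simp

variable [IsNoetherianRing R] [IsAdicComplete (maximalIdeal R) R]

theorem exists_eq_smul (hf : IsInjectiveHull f) (φ : E →ₗ[R] E) : ∃ r : R, ∀ x, φ x = r • x := by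
  choose r hr using fun n => hf.exists_smul_of_pow_le φ (maximalIdeal R ^ n) le_rfl
  have hcauchy : ∀ {m n : ℕ}, m ≤ n → r m ≡ r n [SMOD (maximalIdeal R ^ m • ⊤ : Ideal R)] := by
    intro m n hmn
    rw [SModEq.sub_mem, smul_eq_mul, Ideal.mul_top,
      ← hf.isCogenerator.annihilator_torsionBySet (maximalIdeal R ^ m), Submodule.mem_annihilator]
    intro x hx
    rw [sub_smul, ← hr m x hx, ← hr n x (Submodule.torsionBySet_le_torsionBySet_of_subset
      (Ideal.pow_le_pow_right hmn) hx), sub_self]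
  obtain ⟨s, hs⟩ := IsPrecomplete.prec' (I := maximalIdeal R) r hcauchy
  refine ⟨s, fun x => ?_⟩
  obtain ⟨n, hn⟩ := hf.exists_pow_le_torsionOf x
  have hsn : r n - s ∈ maximalIdeal R ^ n := by simpa [SModEq.sub_mem] using hs n
  rw [hr n x (mem_torsionBySet_iff_le_torsionOf.2 hn), ← sub_eq_zero, ← sub_smul]
  exact hn hsn

theorem torsionBySet_annihilator_le (hf : IsInjectiveHull f) (N : Submodule R E) :
    Submodule.torsionBySet R E N.annihilator ≤ N := by
  intro z hz
  by_contra hzN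
  obtain ⟨g, hg⟩ := hf.isCogenerator (N.mkQ z) (mt (Submodule.Quotient.mk_eq_zero N).1 hzN)
  obtain ⟨r, hr⟩ := hf.exists_eq_smul (g ∘ₗ N.mkQ)
  have hrN : r ∈ N.annihilator := Submodule.mem_annihilator.2 fun n hn => by
    rw [← hr n, LinearMap.comp_apply, Submodule.mkQ_apply, (Submodule.Quotient.mk_eq_zero N).2 hn,
      map_zero]
  exact hg ((hr z).trans ((Submodule.mem_torsionBySet_iff _ _).1 hz ⟨r, hrN⟩))

end IsInjectiveHull

theorem torsionBySet_annihilator_residueHull_le [IsNoetherianRing R]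
    [IsAdicComplete (maximalIdeal R) R] (N : Submodule R (ResidueHull R)) :
    Submodule.torsionBySet R (ResidueHull R) N.annihilator ≤ N := by
  classical
  let e : ResidueHull R ≃ₗ[R] InjectiveHull R (R ⧸ maximalIdeal R) :=
    DirectSum.linearEquivFunOnFintype R (MaximalSpectrum R) _ ≪≫ₗ
      LinearEquiv.piUnique R _
  intro z hz
  have hez : e z ∈ N.map e.toLinearMap := by
    apply (InjectiveHull.isInjectiveHull R _).torsionBySet_annihilator_le
    have hN : (N.map e.toLinearMap).annihilator = N.annihilator :=
      (e.submoduleMap N).annihilator_eq.symm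
    rw [hN, Submodule.mem_torsionBySet_iff]
    intro r
    rw [← map_smul, (Submodule.mem_torsionBySet_iff _ _).1 hz r, map_zero]
  simpa using hez

end MatlisDuality

section Circ

variable {R : Type u} [CommRing R]

theorem circ_le_nonZeroDivisors [IsReduced R] : circ R ≤ nonZeroDivisors R := by
  refine fun c hc => mem_nonZeroDivisors_iff_right.2 fun y hy => ?_
  by_contra hy0
  have hmem : c ∈ ⋃ P ∈ (⊥ : Ideal R).minimalPrimes, (P : Set R) := by
    rw [Ideal.iUnion_minimalPrimes]
    exact ⟨y, by simpa [isNilpotent_iff_eq_zero] using hy0, by simp [mul_comm y c ▸ hy]⟩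
  obtain ⟨P, hP, hcP⟩ := Set.mem_iUnion₂.1 hmem
  exact hc P hP hcP

theorem exists_mem_circ_of_not_le [IsNoetherianRing R] {I : Ideal R}
    (hI : ∀ Q ∈ minimalPrimes R, ¬ I ≤ Q) : ∃ c ∈ circ R, c ∈ I := by
  by_contra! h
  have hsub : (I : Set R) ⊆ ⋃ Q ∈ minimalPrimes R, (Q : Set R) := fun x hx => by
    by_contra hxQ
    exact h x (fun Q hQ hxq => hxQ (Set.mem_biUnion hQ hxq)) hx
  obtain ⟨Q, hQ, hle⟩ := (Ideal.subset_union_prime_finite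
    (minimalPrimes.finite_of_isNoetherianRing R) (f := fun Q => Q) ⊥ ⊥
      fun Q hQ _ _ => hQ.1.1).1 hsub
  exact hI Q hQ hle

theorem exists_comp_eq_smul_id_of_projective (S : Submonoid R) {F M : Type*} [AddCommGroup F]
    [Module R F] [AddCommGroup M] [Module R M] [Module.FinitePresentation R M]
    [Module.Projective (Localization S) (LocalizedModule S M)] {π : F →ₗ[R] M}
    (hπ : Function.Surjective π) : ∃ c ∈ S, ∃ σ : M →ₗ[R] F, π ∘ₗ σ = c • LinearMap.id := by
  let ιM := LocalizedModule.mkLinearMap S M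
  let ιF := LocalizedModule.mkLinearMap S F
  obtain ⟨σ', hσ'⟩ := Module.projective_lifting_property (LocalizedModule.map S π) LinearMap.id
    (IsLocalizedModule.map_surjective S ιF ιM π hπ)
  obtain ⟨σ, s, hσ⟩ := Module.FinitePresentation.exists_lift_of_isLocalizedModule S ιF
    (σ'.restrictScalars R ∘ₗ ιM)
  have hloc : ιM ∘ₗ π ∘ₗ σ = ιM ∘ₗ ((s : R) • LinearMap.id) := by
    have hcomp : ιM ∘ₗ π = (LocalizedModule.map S π).restrictScalars R ∘ₗ ιF :=
      (IsLocalizedModule.map_comp S ιF ιM π).symm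
    rw [← LinearMap.comp_assoc, hcomp, LinearMap.comp_assoc, hσ]
    ext x
    simpa [Submonoid.smul_def] using congrArg ((s : R) • ·) (LinearMap.congr_fun hσ' (ιM x))
  obtain ⟨t, ht⟩ := Module.Finite.exists_smul_of_comp_eq_of_isLocalizedModule S ιM _ _ hloc
  refine ⟨t * s, mul_mem t.2 s.2, (t : R) • σ, ?_⟩
  rw [LinearMap.comp_smul, mul_smul]
  exact ht

theorem exists_comp_eq_smul_id [IsNoetherianRing R] [IsReduced R] {F M : Type*}
    [AddCommGroup F] [Module R F] [AddCommGroup M] [Module R M] [Module.Finite R M]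
    {π : F →ₗ[R] M} (hπ : Function.Surjective π) :
    ∃ c ∈ circ R, ∃ σ : M →ₗ[R] F, π ∘ₗ σ = c • LinearMap.id := by
  let D : Ideal R := (LinearMap.range (LinearMap.compRight R (M := M) π)).comap
    (LinearMap.toSpanSingleton R (M →ₗ[R] M) LinearMap.id)
  suffices h : ∀ Q ∈ minimalPrimes R, ¬ D ≤ Q from exists_mem_circ_of_not_le h
  intro Q hQ hDQ
  have := hQ.1.1
  have : Ring.KrullDimLE 0 (Localization.AtPrime Q) := .of_isLocalization _ hQ _
  let : Field (Localization.AtPrime Q) := Ring.KrullDimLE.isField_of_isReduced.toField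
  have := Module.finitePresentation_of_finite R M
  obtain ⟨c, hcQ, hc⟩ := exists_comp_eq_smul_id_of_projective Q.primeCompl hπ
  exact hcQ (hDQ hc)

end Circ

section Cartier

variable (p : ℕ) [Fact p.Prime] {R : Type u} [CommRing R] [CharP R p]

/-- The ideal of all values at `d` of the `R`-linear maps `ᵉR → R`, that is, of the `p⁻ᵉ`-linear
maps `R → R`. -/
noncomputable def cartierImage (e : ℕ) (d : R) : Ideal R :=
  LinearMap.range (LinearMap.applyₗ (R := R) (M₂ := R) (FrobeniusTwist.of p e R d))

variable {p}

theorem mem_cartierImage {e : ℕ} {d r : R} : r ∈ cartierImage p e d ↔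
    ∃ φ : R →+ R, (∀ a x, φ (a ^ p ^ e * x) = a * φ x) ∧ φ d = r := by
  constructor
  · rintro ⟨l, rfl⟩
    exact ⟨l.toAddMonoidHom.comp (FrobeniusTwist.of p e R : R →+ FrobeniusTwist p e R),
      fun a x => l.map_smul a (FrobeniusTwist.of p e R x), rfl⟩
  · rintro ⟨φ, hφ, rfl⟩
    exact ⟨{ toFun := fun x => φ ((FrobeniusTwist.of p e R).symm x)
             map_add' := fun x y => by rw [map_add, map_add]
             map_smul' := fun a x => hφ a x }, rfl⟩

theorem self_mem_cartierImage_zero (d : R) : d ∈ cartierImage p 0 d :=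
  mem_cartierImage.2 ⟨AddMonoidHom.id R, fun a x => by simp, rfl⟩

theorem cartierImage_le_of_mem {e e' : ℕ} {d r : R} (h : r ∈ cartierImage p e d) :
    cartierImage p e' r ≤ cartierImage p (e + e') d := by
  intro s hs
  obtain ⟨φ, hφ, rfl⟩ := mem_cartierImage.1 h
  obtain ⟨ψ, hψ, rfl⟩ := mem_cartierImage.1 hs
  refine mem_cartierImage.2 ⟨ψ.comp φ, fun a x => ?_, rfl⟩
  rw [AddMonoidHom.comp_apply, add_comm, pow_add, pow_mul, hφ, hψ, AddMonoidHom.comp_apply]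

theorem cartierImage_le_of_dvd {e : ℕ} {d d' : R} (h : d ∣ d') :
    cartierImage p e d' ≤ cartierImage p e d := by
  intro r hr
  obtain ⟨b, rfl⟩ := h
  obtain ⟨φ, hφ, rfl⟩ := mem_cartierImage.1 hr
  refine mem_cartierImage.2 ⟨φ.comp (AddMonoidHom.mulLeft b), fun a x => ?_, ?_⟩
  · simp [mul_left_comm b, hφ]
  · simp [mul_comm b]

theorem mul_mem_cartierImage_pow_mul {e : ℕ} {d r : R} (b : R) (h : r ∈ cartierImage p e d) :
    b * r ∈ cartierImage p e (b ^ p ^ e * d) := by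
  obtain ⟨φ, hφ, rfl⟩ := mem_cartierImage.1 h
  exact mem_cartierImage.2 ⟨φ, hφ, hφ b d⟩

theorem finite_frobeniusTwist (h : IsFFinite p R) (e : ℕ) :
    Module.Finite R (FrobeniusTwist p e R) := by
  have hpow : (iterateFrobenius R p e).Finite := by
    rw [iterateFrobenius_eq_pow]
    induction e with
    | zero => exact RingHom.Finite.id R
    | succ e ih => exact ih.comp h
  exact (RingHom.Finite.of_surjective _ (FrobeniusTwist.of p e R).surjective).comp hpow

theorem of_tmul_residueHull_eq_zero_iff [IsNoetherianRing R] (h : IsFFinite p R) {e : ℕ} {a : R}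
    {z : ResidueHull R} :
    FrobeniusTwist.of p e R a ⊗ₜ[R] z = 0 ↔ ∀ r ∈ cartierImage p e a, r • z = 0 := by
  have := finite_frobeniusTwist h e
  have := Module.finitePresentation_of_finite R (FrobeniusTwist p e R)
  refine ⟨?_, fun hz => tmul_residueHull_eq_zero fun φ => hz _ ⟨φ, rfl⟩⟩
  rintro hz _ ⟨φ, rfl⟩
  exact smul_eq_zero_of_tmul_eq_zero hz φ

end Cartier

section PFamily

/-- The condition `𝔠(e)^{[p]} ⊆ 𝔠(e + 1)` on a sequence of ideals, the `e`-th of which is thought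
of as attached to `q = p ^ e`; it holds for the ideals `𝔞^⌈t q⌉`. -/
def IsPFamily (p : ℕ) {R : Type u} [CommRing R] (𝔠 : ℕ → Ideal R) : Prop :=
  ∀ e, ∀ x ∈ 𝔠 e, x ^ p ∈ 𝔠 (e + 1)

variable {p : ℕ} {R : Type u} [CommRing R]

theorem IsPFamily.pow_mem {𝔠 : ℕ → Ideal R} (h𝔠 : IsPFamily p 𝔠) {e : ℕ} {x : R} (hx : x ∈ 𝔠 e)
    (k : ℕ) : x ^ p ^ k ∈ 𝔠 (e + k) := by
  induction k with
  | zero => simpa using hx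
  | succ k ih =>
    rw [pow_succ, pow_mul]
    exact h𝔠 _ _ ih

theorem isPFamily_realPower (𝔞 : Ideal R) (t : ℝ) : IsPFamily p (realPower p 𝔞 t) := by
  intro e x hx
  have hxp := Ideal.pow_mem_pow hx p
  rw [realPower, ← pow_mul] at hxp
  refine Ideal.pow_le_pow_right (Nat.ceil_le.2 ?_) hxp
  push_cast
  rw [pow_succ, ← mul_assoc]
  gcongr
  exact Nat.le_ceil _

end PFamily

section TestElements

variable {p : ℕ} [Fact p.Prime] {R : Type u} [CommRing R] [CharP R p]

theorem exists_forall_mul_mem_cartierImage_pow [IsNoetherianRing R] [IsReduced R]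
    (h : IsFFinite p R) : ∃ c ∈ circ R, ∀ y : R, c * y ∈ cartierImage p 1 y ^ p := by
  have := finite_frobeniusTwist h 1
  obtain ⟨n, π, hπ⟩ := Module.Finite.exists_fin' R (FrobeniusTwist p 1 R)
  obtain ⟨c, hc, σ, hσ⟩ := exists_comp_eq_smul_id hπ
  refine ⟨c ^ p, pow_mem hc p, fun y => ?_⟩
  set v := σ (FrobeniusTwist.of p 1 R y)
  have hv : c ^ p * y = ∑ i, v i ^ p *
      (FrobeniusTwist.of p 1 R).symm (π (Pi.single i 1)) := by
    have hsum : c • FrobeniusTwist.of p 1 R y = ∑ i, v i • π (Pi.single i 1) :=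
      calc c • FrobeniusTwist.of p 1 R y = π v := (LinearMap.congr_fun hσ _).symm
        _ = π (∑ i, v i • Pi.single i 1) := by rw [← pi_eq_sum_univ' v]
        _ = ∑ i, v i • π (Pi.single i 1) := by simp only [map_sum, map_smul]
    have := congrArg (FrobeniusTwist.of p 1 R).symm hsum
    simpa [Algebra.smul_def, FrobeniusTwist.algebraMap_apply] using this
  rw [hv]
  exact Ideal.sum_mem _ fun i _ => Ideal.mul_mem_right _ _
    (Ideal.pow_mem_pow (LinearMap.mem_range.2 ⟨LinearMap.proj i ∘ₗ σ, rfl⟩) p)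

theorem sq_mem_cartierImage_sq {c : R} (hc : c ∈ cartierImage p 1 (1 : R)) (k : ℕ) :
    c ^ 2 ∈ cartierImage p k (c ^ 2) := by
  induction k with
  | zero => exact self_mem_cartierImage_zero _
  | succ k ih =>
    refine cartierImage_le_of_mem ih (cartierImage_le_of_dvd
      (pow_dvd_pow c (Fact.out : p.Prime).two_le) ?_)
    simpa [sq] using mul_mem_cartierImage_pow_mul c hc

theorem exists_eq_top_of_forall_le_pow {L : Type*} [CommRing L] [IsNoetherianRing L] {n : ℕ}
    (hn : 2 ≤ n) {K : ℕ → Ideal L} (hK : ∀ e, K e ≤ K (e + 1) ^ n) {d : L}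
    (hd : d ∈ nonZeroDivisors L) (hdK : d ∈ K 0) : ∃ e, K e = ⊤ := by
  have hmono : Monotone K := monotone_nat_of_le_succ fun e =>
    (hK e).trans (Ideal.pow_le_self (by lia))
  obtain ⟨e, he⟩ := monotone_stabilizes_iff_noetherian.2 ‹IsNoetherianRing L› ⟨K, hmono⟩
  have hidem : IsIdempotentElem (K e) := by
    refine le_antisymm Ideal.mul_le_left ?_
    calc K e ≤ K (e + 1) ^ n := hK e
      _ = K e ^ n := by rw [show K e = K (e + 1) from he (e + 1) e.le_succ]
      _ ≤ K e ^ 2 := Ideal.pow_le_pow_right hn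
      _ = K e * K e := sq _
  obtain ⟨ε, hε, hKε⟩ := (Ideal.isIdempotentElem_iff_of_fg _ (IsNoetherian.noetherian _)).1 hidem
  obtain ⟨a, rfl⟩ := Ideal.mem_span_singleton'.1 (hKε ▸ hmono e.zero_le hdK)
  have hε1 : ε = 1 := by
    refine (sub_eq_zero.1 (mem_nonZeroDivisors_iff_left.1 hd (1 - ε) ?_)).symm
    rw [mul_assoc, mul_sub, mul_one, hε.eq, sub_self, mul_zero]
  exact ⟨e, by rw [hKε, hε1, Ideal.submodule_span_eq, Ideal.span_singleton_one]⟩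

theorem exists_pow_mem_cartierImage [IsNoetherianRing R] [IsReduced R] {c : R}
    (hc : ∀ y : R, c * y ∈ cartierImage p 1 y ^ p) {d : R} (hd : d ∈ circ R) :
    ∃ e m, c ^ m ∈ cartierImage p e d := by
  let L := Localization.Away c
  let K (e : ℕ) : Ideal L := (cartierImage p e d).map (algebraMap R L)
  have hu : IsUnit (algebraMap R L c) := IsLocalization.Away.algebraMap_isUnit c
  have hK (e : ℕ) : K e ≤ K (e + 1) ^ p := by
    refine Ideal.map_le_iff_le_comap.2 fun r hr => ?_
    rw [Ideal.mem_comap, ← Ideal.unit_mul_mem_iff_mem _ hu, ← map_mul, ← Ideal.map_pow]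
    exact Ideal.mem_map_of_mem _ (Ideal.pow_right_mono (cartierImage_le_of_mem hr) p (hc r))
  obtain ⟨e, he⟩ := exists_eq_top_of_forall_le_pow (Fact.out : p.Prime).two_le hK
    (IsLocalization.map_nonZeroDivisors_le (Submonoid.powers c) L
      (Submonoid.mem_map_of_mem _ (circ_le_nonZeroDivisors hd)))
    (Ideal.mem_map_of_mem _ (self_mem_cartierImage_zero d))
  have hmeet : ¬ Disjoint (Submonoid.powers c : Set R) (cartierImage p e d) :=
    fun hdisj => (IsLocalization.map_algebraMap_ne_top_iff_disjoint _ L _).2 hdisj he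
  obtain ⟨_, ⟨m, rfl⟩, hm⟩ := Set.not_disjoint_iff.1 hmeet
  exact ⟨e, m, hm⟩

theorem exists_mem_circ_forall_exists_mem_cartierImage [IsNoetherianRing R] [IsReduced R]
    (h : IsFFinite p R) :
    ∃ c ∈ circ R, ∀ d ∈ circ R, ∀ e₀ : ℕ, ∃ e ≥ e₀, c ∈ cartierImage p e d := by
  obtain ⟨c, hc, hcy⟩ := exists_forall_mul_mem_cartierImage_pow h
  have hc1 : c ∈ cartierImage p 1 (1 : R) := by
    simpa using Ideal.pow_le_self (Fact.out : p.Prime).ne_zero (hcy 1)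
  refine ⟨c * c ^ 2, mul_mem hc (pow_mem hc 2), fun d hd e₀ => ?_⟩
  obtain ⟨e, m, hm⟩ := exists_pow_mem_cartierImage hcy hd
  have hdvd : c ^ m ∣ c ^ p ^ (e₀ + m) * c ^ 2 := by
    have : e₀ + m < p ^ (e₀ + m) := Nat.lt_pow_self (Fact.out : p.Prime).one_lt
    exact Dvd.dvd.mul_right (pow_dvd_pow c (by lia)) _
  exact ⟨e + (e₀ + m), by lia, cartierImage_le_of_mem hm (cartierImage_le_of_dvd hdvd
    (mul_mem_cartierImage_pow_mul c (sq_mem_cartierImage_sq hc1 (e₀ + m))))⟩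

theorem torsionBySet_tauTildeAlong_le [IsNoetherianRing R] [IsReduced R] (h : IsFFinite p R)
    {𝔠 : ℕ → Ideal R} (h𝔠 : IsPFamily p 𝔠) :
    Submodule.torsionBySet R (ResidueHull R) (tauTildeAlong p 𝔠) ≤ tightClosureAlong p 𝔠 ⊥ := by
  obtain ⟨c, hc, hcd⟩ := exists_mem_circ_forall_exists_mem_cartierImage h
  have hτ (e : ℕ) (x : R) (hx : x ∈ 𝔠 e) : cartierImage p e (c * x) ≤ tauTildeAlong p 𝔠 := by
    refine fun r hr => Submodule.mem_annihilator.2 fun y hy => ?_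
    obtain ⟨d, hd, hdy⟩ := (mem_tightClosureAlong_bot p).1 hy
    obtain ⟨e₀, he₀⟩ := Filter.eventually_atTop.1 hdy
    obtain ⟨k, hk, hck⟩ := hcd d hd e₀
    have hcx : c * x ∈ cartierImage p k (d * x ^ p ^ k) := by
      simpa only [mul_comm] using mul_mem_cartierImage_pow_mul x hck
    exact (of_tmul_residueHull_eq_zero_iff h).1
      (he₀ (k + e) (by lia) _ (add_comm e k ▸ h𝔠.pow_mem hx k)) r (cartierImage_le_of_mem hcx hr)
  intro z hz
  exact (mem_tightClosureAlong_bot p).2 ⟨c, hc, Filter.Eventually.of_forall fun e x hx =>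
    (of_tmul_residueHull_eq_zero_iff h).2 fun r hr =>
      (Submodule.mem_torsionBySet_iff _ _).1 hz ⟨r, hτ e x hx hr⟩⟩

end TestElements

end TestIdeal

theorem proposition2p2_general (p : ℕ) [Fact p.Prime] (R : Type u) [CommRing R]
    [IsNoetherianRing R] [CharP R p] (I : Ideal R) (𝔠 𝔡 : ℕ → Ideal R) :
    (IsReduced R → TestIdeal.IsFFinite p R → TestIdeal.IsPFamily p 𝔡 →
      TestIdeal.tightClosureAlong p (M := R) 𝔠 I * TestIdeal.tauTildeAlong p (𝔠 * 𝔡) ≤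
        I * TestIdeal.tauTildeAlong p 𝔡) ∧
    (∀ [IsLocalRing R] [IsAdicComplete (IsLocalRing.maximalIdeal R) R],
      TestIdeal.tightClosureAlong p (M := R) 𝔠 I * TestIdeal.tauAlong p (𝔠 * 𝔡) ≤
        I * TestIdeal.tauAlong p 𝔡) := by
  have hE := TestIdeal.isCogenerator_residueHull R
  have hI : I.FG := IsNoetherian.noetherian I
  constructor
  · intro _ hF h𝔡
    exact hE.mul_annihilator_le (TestIdeal.torsionBySet_tauTildeAlong_le hF h𝔡) fun _ =>
      TestIdeal.tightClosureAlong_smul_le p hI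
  · intro _ _
    simp only [← TestIdeal.annihilator_finitisticTightClosure]
    exact hE.mul_annihilator_le (TestIdeal.torsionBySet_annihilator_residueHull_le _) fun _ =>
      TestIdeal.finitisticTightClosure_smul_le p hI

theorem proposition2p2 (p : ℕ) [Fact p.Prime] (R : Type u) [CommRing R] [IsNoetherianRing R]
    [IsReduced R] [CharP R p] :
    (TestIdeal.IsFFinite p R →
      ∀ 𝔞 𝔟 : Ideal R, TestIdeal.MeetsCirc 𝔞 → TestIdeal.MeetsCirc 𝔟 →
      ∀ t s : ℝ, 0 < t → 0 < s →
        TestIdeal.idealTightClosure p (TestIdeal.tauTilde p 𝔞 t) 𝔞 t *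
            TestIdeal.tauTildeMul p 𝔞 t 𝔟 s ≤
          TestIdeal.tauTilde p 𝔞 t * TestIdeal.tauTilde p 𝔟 s) ∧
    (∀ [IsLocalRing R] [IsAdicComplete (IsLocalRing.maximalIdeal R) R],
      ∀ 𝔞 𝔟 : Ideal R, 0 < 𝔞.height → 0 < 𝔟.height →
      ∀ t s : ℝ, 0 < t → 0 < s →
        TestIdeal.idealTightClosure p (TestIdeal.tau p 𝔞 t) 𝔞 t *
            TestIdeal.tauMul p 𝔞 t 𝔟 s ≤
          TestIdeal.tau p 𝔞 t * TestIdeal.tau p 𝔟 s) :=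
  ⟨fun hF _ 𝔟 _ _ _ s _ _ => (proposition2p2_general p R _ _ _).1 inferInstance hF
      (TestIdeal.isPFamily_realPower 𝔟 s),
    fun _ _ _ _ _ _ _ _ => (proposition2p2_general p R _ _ _).2⟩
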